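/- **Setting.** Let $\mu$ be a finite Borel measure on the unit circle $\mathbb T$, $E$ a separable Hilbert space with orthonormal basis $(e_n)_{n\ge1}$ (finite or infinite), $N:\mathbb T\to\{0,1,2,\dots,\infty\}$ measurable, $E(\xi)=\overline{\operatorname{span}}\{e_n:n\le N(\xi)\}$, and let $\mathcal H=\int^{\oplus}_{\mathbb T}E(\xi)\,d\mu(\xi)=\{f\in L^2(\mu;E): f(\xi)\in E(\xi)\ \mu\text{-a.e.}\}$, with $U=M_\xi$ the multiplication by the independent variable on $\mathcal H$. Let $\mathfrak D=\mathfrak D_*=\mathbb C^d$, let $\mathbf B:\mathbb C^d\to\mathcal H$ be an isometry, $b_k=\mathbf B e_k$ the image of the $k$-th standard basis vector of $\mathbb C^d$, and $B^*(\xi)$ the column of the functionals $b_1(\xi)^*,\dots,b_d(\xi)^*$. Let $\Gamma$ be a $d\times d$ matrix with $\|\Gamma x\|<\|x\|$ for all $x\ne0$, and $$T=U+\mathbf B(\Gamma-\mathbf I)\mathbf B^*U .$$ For a contraction $A$ put $D_A=(\mathbf I-A^*A)^{1/2}$ and $\mathfrak D_A=\overline{\operatorname{Ran}}\,D_A$.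 Let $V:\mathfrak D_T\to\mathbb C^d$ and $V_*:\mathfrak D_{T^*}\to\mathbb C^d$ be any unitary operators, and let $\theta$ be the corresponding characteristic function of $T$, i.e. the boundary values on $\mathbb T$ of $$\theta(z)=V_*\bigl(-T+zD_{T^*}(\mathbf I-zT^*)^{-1}D_T\bigr)V^*,\qquad |z|<1 .$$ Fix any transcription of the functional model for $\theta$: a measurable function $W$ on $\mathbb T$ whose values are positive semidefinite operators on $\mathfrak D_*\oplus\mathfrak D$, the weighted space $L^2(W;\mathfrak D_*\oplus\mathfrak D)$ with $\|f\|^2=\int_{\mathbb T}\langle W f,f\rangle\,dm$ ($m$ is normalized Lebesgue measure; functions at distance $0$ are identified), and isometries $\pi:L^2(\mathfrak D)\to L^2(W;\mathfrak D_*\oplus\mathfrak D)$, $\pi_*:L^2(\mathfrak D_*)\to L^2(W;\mathfrak D_*\oplus\mathfrak D)$ that commute with $M_z$ and satisfy $\pi_*^*\pi=\theta$ (multiplication by $\theta$). The model space is $$\mathcal K_\theta=\overline{\pi L^2(\mathfrak D)+\pi_*L^2(\mathfrak D_*)}\ominus\bigl(\pi H^2(\mathfrak D)\oplus\pi_*H^2_-(\mathfrak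 D_*)\bigr),\qquad H^2_-=L^2\ominus H^2,$$ and the model operator is $\mathcal M_\theta=P_{\mathcal K_\theta}M_z|_{\mathcal K_\theta}$. Let $\mathbf C:\mathbb C^d\to\mathfrak D_{\mathcal M_\theta}$ and $\mathbf C_*:\mathbb C^d\to\mathfrak D_{\mathcal M_\theta^*}$ be unitary operators that agree with the Clark model: for some Clark operator $\Phi$, that is, a unitary operator $\Phi:\mathcal K_\theta\to\mathcal H$ with $\Phi\mathcal M_\theta=T\Phi$, one has $$\Phi^*(\mathbf B^*U)^*=\mathbf C,\qquad \Phi^*\mathbf B=\mathbf C_* .$$ Let $C(z),C_*(z):\mathbb C^d\to\mathfrak D_*\oplus\mathfrak D$ be the operator-valued functions on $\mathbb T$ with $(\mathbf Cx)(z)=C(z)x$ and $(\mathbf C_*x)(z)=C_*(z)x$ for all $x\in\mathbb C^d$. **Theorem 2.1 (Representation Theorem).** For every such $\Phi$, every $b\in\operatorname{Ran}\mathbf B$ and every scalar $h\in C^1(\mathbb T)$, $$(\Phi^*hb)(z)=h(z)\,C_*(z)\,\mathbf B^*b+\bigl(C_*(z)-zC(z)\bigr)\int_{\mathbb T}\frac{h(\xi)-h(z)}{1-z\bar\xi}\,B^*(\xi)b(\xi)\,d\mu(\xi)$$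 as elements of $L^2(W;\mathfrak D_*\oplus\mathfrak D)$. Here $\mathbf B^*b=\int_{\mathbb T}B^*(\xi)b(\xi)\,d\mu(\xi)$, and both integrals converge absolutely, the former for every $z\in\mathbb T$ (the integrand is taken to be $0$ at $\xi=z$; since $\mu$ has at most countably many atoms, this value is irrelevant for almost every $z$). -/

import Mathlib

open MeasureTheory Filter Topology
open scoped ComplexConjugate ContDiff

noncomputable section

namespace ClarkModel

instance instMeasurableSpaceCircle : MeasurableSpace Circle := borel Circle

instance instBorelSpaceCircle : BorelSpace Circle := ⟨rfl⟩

/-- Normalized Lebesgue measure `m` on the unit circle. -/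
def arcMeasure : Measure Circle :=
  (ENNReal.ofReal (2 * Real.pi))⁻¹ • (volume.restrict (Set.Ioc 0 (2 * Real.pi))).map Circle.exp

/-! ### Multiplication by a continuous function on vector-valued `L²` spaces -/

section Mul

variable {X : Type*} [NormedAddCommGroup X] [NormedSpace ℂ X]

theorem memLp_mul (ν : Measure Circle) (h : C(Circle, ℂ)) (f : Lp X 2 ν) :
    MemLp (fun z => h z • f z) 2 ν := by
  refine (Lp.memLp f).of_le_mul (c := ‖h‖)
    (h.continuous.aestronglyMeasurable.smul (Lp.aestronglyMeasurable f)) ?_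
  filter_upwards with z
  rw [norm_smul]
  exact mul_le_mul_of_nonneg_right (h.norm_coe_le_norm z) (norm_nonneg _)

/-- The operator of multiplication by `h` on `L²(ν; X)`. -/
def mulOp (ν : Measure Circle) (h : C(Circle, ℂ)) : Lp X 2 ν →L[ℂ] Lp X 2 ν :=
  LinearMap.mkContinuous
    { toFun := fun f => (memLp_mul ν h f).toLp _
      map_add' := by
        intro f g
        apply Lp.ext
        filter_upwards [(memLp_mul ν h (f + g)).coeFn_toLp, (memLp_mul ν h f).coeFn_toLp,
          (memLp_mul ν h g).coeFn_toLp, Lp.coeFn_add f g,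
          Lp.coeFn_add ((memLp_mul ν h f).toLp _) ((memLp_mul ν h g).toLp _)]
          with z h1 h2 h3 h4 h5
        rw [h1, h5, Pi.add_apply, h2, h3, h4, Pi.add_apply, smul_add]
      map_smul' := by
        intro c f
        apply Lp.ext
        filter_upwards [(memLp_mul ν h (c • f)).coeFn_toLp, (memLp_mul ν h f).coeFn_toLp,
          Lp.coeFn_smul c f, Lp.coeFn_smul c ((memLp_mul ν h f).toLp _)]
          with z h1 h2 h3 h4
        rw [h1, RingHom.id_apply, h4, Pi.smul_apply, h2, h3, Pi.smul_apply, smul_comm] }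
    ‖h‖ (by
      intro f
      apply Lp.norm_le_mul_norm_of_ae_le_mul
      filter_upwards [(memLp_mul ν h f).coeFn_toLp] with z hz
      change ‖((memLp_mul ν h f).toLp _ : Lp X 2 ν) z‖ ≤ _
      rw [hz, norm_smul]
      exact mul_le_mul_of_nonneg_right (h.norm_coe_le_norm z) (norm_nonneg _))

theorem coeFn_mulOp (ν : Measure Circle) (h : C(Circle, ℂ)) (f : Lp X 2 ν) :
    mulOp ν h f =ᵐ[ν] fun z => h z • f z :=
  (memLp_mul ν h f).coeFn_toLp

/-- The independent variable as a continuous function on the circle. -/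
def idCoord : C(Circle, ℂ) := ⟨fun z => (z : ℂ), continuous_induced_dom⟩

end Mul

/-! ### Measurable sections and the direct integral -/

section DirectIntegral

variable {E : Type*} [NormedAddCommGroup E] [InnerProductSpace ℂ E]

/-- The subspace of all `f ∈ L²(μ; E)` with `f(ξ) ∈ F(ξ)` for `μ`-a.e. `ξ`. -/
def sections (μ : Measure Circle) (F : Circle → Submodule ℂ E) : Submodule ℂ (Lp E 2 μ) where
  carrier := {f | ∀ᵐ ξ ∂μ, f ξ ∈ F ξ}
  add_mem' := by
    intro f g hf hg
    filter_upwards [hf, hg, Lp.coeFn_add f g] with ξ h1 h2 h3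
    rw [h3]
    exact (F ξ).add_mem h1 h2
  zero_mem' := by
    filter_upwards [Lp.coeFn_zero E 2 μ] with ξ h1
    rw [h1]
    exact (F ξ).zero_mem
  smul_mem' := by
    intro c f hf
    filter_upwards [hf, Lp.coeFn_smul c f] with ξ h1 h2
    rw [h2]
    exact (F ξ).smul_mem c h1

theorem isClosed_sections (μ : Measure Circle) (F : Circle → Submodule ℂ E)
    (hF : ∀ ξ, IsClosed (F ξ : Set E)) : IsClosed (sections μ F : Set (Lp E 2 μ)) := by
  apply IsSeqClosed.isClosed
  intro u f hu hf
  obtain ⟨ns, -, hns⟩ := (tendstoInMeasure_of_tendsto_Lp hf).exists_seq_tendsto_ae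
  have hall : ∀ᵐ ξ ∂μ, ∀ n, u n ξ ∈ F ξ := ae_all_iff.2 hu
  filter_upwards [hns, hall] with ξ h1 h2
  exact (hF ξ).mem_of_tendsto h1 (Eventually.of_forall fun n => h2 (ns n))

theorem mulOp_mem_sections (μ : Measure Circle) (F : Circle → Submodule ℂ E)
    (h : C(Circle, ℂ)) (f : Lp E 2 μ) (hf : f ∈ sections μ F) :
    mulOp μ h f ∈ sections μ F := by
  filter_upwards [hf, coeFn_mulOp μ h f] with ξ h1 h2
  rw [h2]
  exact (F ξ).smul_mem _ h1

variable {M : ℕ∞}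

/-- The fibre `E(ξ)`, the closed span of the first `N(ξ)` vectors of the fixed orthonormal
basis of `E` (`M = dim E ∈ ℕ ∪ {∞}`; the basis is indexed from `0`). -/
def fiber (e : HilbertBasis {n : ℕ // (n : ℕ∞) < M} ℂ E) (N : Circle → ℕ∞) (ξ : Circle) :
    Submodule ℂ E :=
  (Submodule.span ℂ
    {x | ∃ n : {n : ℕ // (n : ℕ∞) < M}, (n.1 : ℕ∞) < N ξ ∧ x = e n}).topologicalClosure

/-- The von Neumann direct integral `∫^⊕ E(ξ) dμ(ξ)`, as a subspace of `L²(μ; E)`. -/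
abbrev DirectIntegral (μ : Measure Circle) (e : HilbertBasis {n : ℕ // (n : ℕ∞) < M} ℂ E)
    (N : Circle → ℕ∞) : Submodule ℂ (Lp E 2 μ) :=
  sections μ (fiber e N)

instance instCompleteSpaceDirectIntegral [CompleteSpace E] (μ : Measure Circle)
    (e : HilbertBasis {n : ℕ // (n : ℕ∞) < M} ℂ E) (N : Circle → ℕ∞) :
    CompleteSpace (DirectIntegral μ e N) :=
  (isClosed_sections μ _ fun _ => Submodule.isClosed_topologicalClosure _).completeSpace_coe

/-- Multiplication by a continuous function on the direct integral. -/
def mulH (μ : Measure Circle) (e : HilbertBasis {n : ℕ // (n : ℕ∞) < M} ℂ E)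
    (N : Circle → ℕ∞) (h : C(Circle, ℂ)) :
    DirectIntegral μ e N →L[ℂ] DirectIntegral μ e N :=
  ((mulOp μ h) ∘L (DirectIntegral μ e N).subtypeL).codRestrict (DirectIntegral μ e N)
    fun f => mulOp_mem_sections μ _ h f.1 f.2

end DirectIntegral

/-! ### Contractions, defect spaces and the characteristic function -/

section Contraction

variable {H : Type*} [NormedAddCommGroup H] [InnerProductSpace ℂ H] [CompleteSpace H]

/-- The defect operator `D_T = (I - T*T)^{1/2}`. -/
def defectOp (T : H →L[ℂ] H) : H →L[ℂ] H :=
  CFC.sqrt (1 - ContinuousLinearMap.adjoint T * T)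

/-- The defect space `𝔇_T = clos Ran D_T`. -/
def defectSpace (T : H →L[ℂ] H) : Submodule ℂ H :=
  (LinearMap.range (defectOp T).toLinearMap).topologicalClosure

instance instCompleteSpaceDefectSpace (T : H →L[ℂ] H) : CompleteSpace (defectSpace T) :=
  (Submodule.isClosed_topologicalClosure _).completeSpace_coe

/-- The finite-dimensional space `𝔇 = 𝔇_* = ℂ^d`. -/
abbrev Cd (d : ℕ) : Type := EuclideanSpace ℂ (Fin d)

variable {d : ℕ}

/-- The characteristic function of `T` in the open unit disc,
`θ(z) = V_* (-T + z D_{T*} (I - z T*)⁻¹ D_T) V*`, for coordinate operators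
`V : 𝔇_T → ℂ^d` and `V_* : 𝔇_{T*} → ℂ^d` (`V_*` is extended by `0` to `𝔇_{T*}^⊥`). -/
def charFun (T : H →L[ℂ] H) (V : defectSpace T ≃ₗᵢ[ℂ] Cd d)
    (Vs : defectSpace (ContinuousLinearMap.adjoint T) ≃ₗᵢ[ℂ] Cd d) (z : ℂ) : Cd d →L[ℂ] Cd d :=
  (Vs.toContinuousLinearEquiv.toContinuousLinearMap ∘L
      (defectSpace (ContinuousLinearMap.adjoint T)).orthogonalProjectionOnto) ∘L
    (-T + z • (defectOp (ContinuousLinearMap.adjoint T) *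
      Ring.inverse (1 - z • ContinuousLinearMap.adjoint T) * defectOp T)) ∘L
    ((defectSpace T).subtypeL ∘L V.symm.toContinuousLinearEquiv.toContinuousLinearMap)

/-- `θ` on the circle is the boundary function (radial limits a.e.) of `Θ` in the disc. -/
def IsBoundaryFunction (Θ : ℂ → (Cd d →L[ℂ] Cd d)) (θ : Circle → (Cd d →L[ℂ] Cd d)) : Prop :=
  ∀ᵐ z : Circle ∂arcMeasure, Tendsto (fun r : ℝ => Θ ((r : ℂ) * (z : ℂ))) (𝓝[<] 1) (𝓝 (θ z))

end Contraction

/-! ### Weighted spaces with an operator weight -/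

section Weight

/-- The space `𝔇_* ⊕ 𝔇 = ℂ^d ⊕ ℂ^d`. -/
abbrev Cdd (d : ℕ) : Type := EuclideanSpace ℂ (Fin d ⊕ Fin d)

variable {d : ℕ}

/-- A measurable function `f` is a representative of an element of the weighted space
`L²(W; 𝔇_* ⊕ 𝔇)`, with squared norm `∫ ⟨W f, f⟩ dm`. We realize this weighted space
isometrically inside `L²(𝔇_* ⊕ 𝔇)` by `f ↦ W^{1/2} f`; `Represents W f g` says that `g` is the
element given by the function `f`. Two functions give the same element iff
`∫ ⟨W (f₁ - f₂), f₁ - f₂⟩ dm = 0`. -/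
def Represents (W : Circle → (Cdd d →L[ℂ] Cdd d)) (f : Circle → Cdd d)
    (g : Lp (Cdd d) 2 arcMeasure) : Prop :=
  AEStronglyMeasurable f arcMeasure ∧ ∀ᵐ z ∂arcMeasure, CFC.sqrt (W z) (f z) = g z

/-- The weighted space `L²(W; 𝔇_* ⊕ 𝔇)`, realized as the space of all `W^{1/2} f ∈ L²`. -/
def WeightedL2 (W : Circle → (Cdd d →L[ℂ] Cdd d)) : Submodule ℂ (Lp (Cdd d) 2 arcMeasure) where
  carrier := {g | ∃ f, Represents W f g}
  add_mem' := by
    rintro g₁ g₂ ⟨f₁, m₁, h₁⟩ ⟨f₂, m₂, h₂⟩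
    refine ⟨f₁ + f₂, m₁.add m₂, ?_⟩
    filter_upwards [h₁, h₂, Lp.coeFn_add g₁ g₂] with z a b c
    rw [c, Pi.add_apply, Pi.add_apply, map_add, a, b]
  zero_mem' := by
    refine ⟨0, aestronglyMeasurable_zero, ?_⟩
    filter_upwards [Lp.coeFn_zero (Cdd d) 2 arcMeasure] with z a
    rw [a]
    exact map_zero _
  smul_mem' := by
    rintro c g ⟨f, m, h⟩
    refine ⟨c • f, m.const_smul c, ?_⟩
    filter_upwards [h, Lp.coeFn_smul c g] with z a b
    rw [b, Pi.smul_apply, Pi.smul_apply, map_smul, a]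

/-- The norm is the one of the weighted space. -/
theorem Represents.norm_sq {W : Circle → (Cdd d →L[ℂ] Cdd d)} (hW : ∀ z, (W z).IsPositive)
    {f : Circle → Cdd d} {g : Lp (Cdd d) 2 arcMeasure} (h : Represents W f g) :
    ((‖g‖ ^ 2 : ℝ) : ℂ) = ∫ z, inner ℂ (f z) (W z (f z)) ∂arcMeasure := by
  have h0 : ((‖g‖ ^ 2 : ℝ) : ℂ) = inner ℂ g g := by
    rw [inner_self_eq_norm_sq_to_K]
    norm_cast
  rw [h0, L2.inner_def]
  apply integral_congr_ae
  filter_upwards [h.2] with z hz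
  have hp : 0 ≤ W z := (ContinuousLinearMap.nonneg_iff_isPositive _).2 (hW z)
  have hs : (CFC.sqrt (W z)).IsPositive :=
    (ContinuousLinearMap.nonneg_iff_isPositive _).1 (CFC.sqrt_nonneg _)
  have hm : CFC.sqrt (W z) * CFC.sqrt (W z) = W z := CFC.sqrt_mul_sqrt_self (W z) hp
  rw [← hz]
  conv_rhs => rw [← hm]
  exact hs.isSymmetric (f z) (CFC.sqrt (W z) (f z))

end Weight

/-! ### Functional models -/

section Model

variable {d : ℕ}

/-- `n`-th Fourier coefficient `∫ z^{-n} f(z) dm(z)` of `f ∈ L²(ℂ^d)`. -/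
def fourierCoef (f : Lp (Cd d) 2 arcMeasure) (n : ℤ) : Cd d :=
  ∫ z : Circle, ((z : ℂ) ^ (-n)) • f z ∂arcMeasure

/-- Elements of the Hardy space `H²(ℂ^d)`, as boundary functions. -/
def H2 (d : ℕ) : Set (Lp (Cd d) 2 arcMeasure) := {f | ∀ n : ℤ, n < 0 → fourierCoef f n = 0}

/-- Elements of `H²_-(ℂ^d) = L²(ℂ^d) ⊖ H²(ℂ^d)`. -/
def H2minus (d : ℕ) : Set (Lp (Cd d) 2 arcMeasure) := {f | ∀ n : ℤ, 0 ≤ n → fourierCoef f n = 0}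

/-- A transcription of the functional model for `θ`: an operator weight `W` on the circle, and
isometric functional embeddings `emb` of `L²(𝔇)` and `embS` of `L²(𝔇_*)` into `L²(W; 𝔇_* ⊕ 𝔇)`
that commute with multiplication by `z` and satisfy `embS^* emb = θ`. They determine the unitary
map from the space of the minimal unitary dilation into the weighted space. -/
structure Transcription (θ : Circle → (Cd d →L[ℂ] Cd d)) where
  /-- the operator weight -/
  W : Circle → (Cdd d →L[ℂ] Cdd d)
  W_meas : StronglyMeasurable W
  W_pos : ∀ z, (W z).IsPositive
  /-- the outgoing functional embedding -/
  emb : Lp (Cd d) 2 arcMeasure →ₗᵢ[ℂ] Lp (Cdd d) 2 arcMeasure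
  /-- the incoming functional embedding -/
  embS : Lp (Cd d) 2 arcMeasure →ₗᵢ[ℂ] Lp (Cdd d) 2 arcMeasure
  emb_mem : ∀ f, emb f ∈ WeightedL2 W
  embS_mem : ∀ f, embS f ∈ WeightedL2 W
  emb_mul : ∀ f, emb (mulOp arcMeasure idCoord f) = mulOp arcMeasure idCoord (emb f)
  embS_mul : ∀ f, embS (mulOp arcMeasure idCoord f) = mulOp arcMeasure idCoord (embS f)
  inner_embS_emb : ∀ f g, inner ℂ (embS g) (emb f) =
    ∫ z, inner ℂ (g z) (θ z (f z)) ∂arcMeasure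

namespace Transcription

variable {θ : Circle → (Cd d →L[ℂ] Cd d)}

/-- The space of the minimal unitary dilation of the model operator, the closure of
`emb L²(𝔇) + embS L²(𝔇_*)`. -/
def bigSpace (S : Transcription θ) : Submodule ℂ (Lp (Cdd d) 2 arcMeasure) :=
  (LinearMap.range S.emb.toLinearMap ⊔ LinearMap.range S.embS.toLinearMap).topologicalClosure

/-- The model space `K_θ`: the orthogonal complement, in the big space, of the outgoing space
`emb H²(𝔇)` and the incoming space `embS H²_-(𝔇_*)`. -/
def modelSpace (S : Transcription θ) : Submodule ℂ (Lp (Cdd d) 2 arcMeasure) :=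
  S.bigSpace ⊓ (Submodule.span ℂ (S.emb '' H2 d))ᗮ ⊓ (Submodule.span ℂ (S.embS '' H2minus d))ᗮ

instance instCompleteSpaceModelSpace (S : Transcription θ) : CompleteSpace S.modelSpace := by
  have h : IsClosed (S.modelSpace : Set (Lp (Cdd d) 2 arcMeasure)) :=
    ((Submodule.isClosed_topologicalClosure _).inter (Submodule.isClosed_orthogonal _)).inter
      (Submodule.isClosed_orthogonal _)
  exact h.completeSpace_coe

/-- The model operator: the compression of multiplication by `z` to the model space. -/
def modelOp (S : Transcription θ) : S.modelSpace →L[ℂ] S.modelSpace :=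
  S.modelSpace.orthogonalProjectionOnto ∘L mulOp arcMeasure idCoord ∘L S.modelSpace.subtypeL

end Transcription

end Model

/-! ### Finite rank perturbations of `M_ξ` and the Clark operator -/

section Clark

variable {E : Type*} [NormedAddCommGroup E] [InnerProductSpace ℂ E] [CompleteSpace E]
variable {M : ℕ∞} {d : ℕ} {μ : Measure Circle}
variable {e : HilbertBasis {n : ℕ // (n : ℕ∞) < M} ℂ E} {N : Circle → ℕ∞}

/-- The unperturbed operator `U = M_ξ` in the direct integral. -/
abbrev unitaryOp (μ : Measure Circle) (e : HilbertBasis {n : ℕ // (n : ℕ∞) < M} ℂ E)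
    (N : Circle → ℕ∞) : DirectIntegral μ e N →L[ℂ] DirectIntegral μ e N :=
  mulH μ e N idCoord

/-- The adjoint `B* : ℋ → ℂ^d` of the isometry `B : ℂ^d → ℋ`. -/
def adjB (B : Cd d →ₗᵢ[ℂ] DirectIntegral μ e N) : DirectIntegral μ e N →L[ℂ] Cd d :=
  ContinuousLinearMap.adjoint B.toContinuousLinearMap

/-- The perturbation `T_Γ = U + B (Γ - I) B* U`. -/
def perturbation (B : Cd d →ₗᵢ[ℂ] DirectIntegral μ e N) (Γ : Cd d →L[ℂ] Cd d) :
    DirectIntegral μ e N →L[ℂ] DirectIntegral μ e N :=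
  unitaryOp μ e N + B.toContinuousLinearMap ∘L (Γ - 1) ∘L adjB B ∘L unitaryOp μ e N

/-- The function `ξ ↦ B*(ξ) b(ξ)`, whose `k`-th coordinate is `b_k(ξ)* b(ξ)`, where
`b_k = B e_k`. -/
def fiberAdj (B : Cd d →ₗᵢ[ℂ] DirectIntegral μ e N) (b : DirectIntegral μ e N) (ξ : Circle) :
    Cd d :=
  WithLp.toLp 2 fun k : Fin d =>
    inner ℂ ((B (EuclideanSpace.single k 1) : Lp E 2 μ) ξ) ((b : Lp E 2 μ) ξ)

/-- A Clark operator: a unitary operator `Φ : K_θ → ℋ` with `Φ M_θ = T Φ`. -/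
def IsClarkOperator {θ : Circle → (Cd d →L[ℂ] Cd d)} (S : Transcription θ)
    (T : DirectIntegral μ e N →L[ℂ] DirectIntegral μ e N)
    (Φ : S.modelSpace ≃ₗᵢ[ℂ] DirectIntegral μ e N) : Prop :=
  ∀ f, Φ (S.modelOp f) = T (Φ f)

/-- The parametrizing operators `C`, `C_*` agree with the Clark model through the Clark
operator `Φ`: `Φ* (B* U)* = C` and `Φ* B = C_*`. -/
def AgreesVia {θ : Circle → (Cd d →L[ℂ] Cd d)} (S : Transcription θ)
    (B : Cd d →ₗᵢ[ℂ] DirectIntegral μ e N)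
    (Φ : S.modelSpace ≃ₗᵢ[ℂ] DirectIntegral μ e N)
    (C : Cd d ≃ₗᵢ[ℂ] defectSpace S.modelOp)
    (Cs : Cd d ≃ₗᵢ[ℂ] defectSpace (ContinuousLinearMap.adjoint S.modelOp)) : Prop :=
  (∀ x : Cd d, Φ.symm (ContinuousLinearMap.adjoint (adjB B ∘L unitaryOp μ e N) x) = C x) ∧
    ∀ x : Cd d, Φ.symm (B x) = Cs x

/-- `F` is the operator-valued function of the operator `C : ℂ^d → K_θ ⊂ L²(W; 𝔇_* ⊕ 𝔇)`:
`(C x)(z) = F(z) x` for all `x`. -/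
def IsFunctionOf {θ : Circle → (Cd d →L[ℂ] Cd d)} (S : Transcription θ)
    (F : Circle → (Cd d →L[ℂ] Cdd d)) (C : Cd d → S.modelSpace) : Prop :=
  ∀ x : Cd d, Represents S.W (fun z => F z x) (C x : Lp (Cdd d) 2 arcMeasure)

end Clark

end ClarkModel

end

/-! The perturbation `T` differs from `U` only through `B*U`, so on `ker B*U` it equals `U` and is
isometric. The model operator is a compression of the isometry `M_z`; where it preserves the norm it
must be `M_z` itself, so `Φ*U = M_z Φ*` on that kernel. A general `g` is reduced to this case by
subtracting `U*Bv`, `v = B*Ug`: the agreement conditions identify `Φ*U*Bv = Cv` and `Φ*Bv = C_*v`.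
The outcome is `Φ*U = M_z Φ* + (C_* - M_z C) B*U` (`symm_unitaryOp`).

With `g = hb` this is a recurrence from `Φ*(hb)` to `Φ*(ξhb)`. The right-hand side of the formula
obeys the same recurrence at every `z` that is not an atom of `μ`, by an algebraic identity for the
kernel (`chordQuotient_idCoord_mul`). The case `h = 1` is the agreement condition, and since `M_z`
is invertible the recurrence runs both ways, giving all `z^n` and then all trigonometric
polynomials.

Trigonometric polynomials are dense in `C¹` (`exists_trigonometric_approx`), and the kernel is
bounded by the chordal Lipschitz constant of `h`. Hence the right-hand sides converge at every point
while the elements `Φ*(hb)` converge in norm, and `Represents.of_tendsto` passes to the limit. -/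

noncomputable section

namespace ClarkModel

/-! ### Algebra of multiplication operators on `L²` -/

section Mul

variable {X : Type*} [NormedAddCommGroup X] [NormedSpace ℂ X] (ν : Measure Circle)

theorem mulOp_mul (h k : C(Circle, ℂ)) (f : Lp X 2 ν) :
    mulOp ν (h * k) f = mulOp ν h (mulOp ν k f) := by
  apply Lp.ext
  filter_upwards [coeFn_mulOp ν (h * k) f, coeFn_mulOp ν k f,
    coeFn_mulOp ν h (mulOp ν k f)] with z h1 h2 h3
  rw [h1, h3, h2, ContinuousMap.mul_apply, mul_smul]

theorem mulOp_one (f : Lp X 2 ν) : mulOp ν 1 f = f := by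
  apply Lp.ext
  filter_upwards [coeFn_mulOp ν 1 f] with z h1
  rw [h1, ContinuousMap.one_apply, one_smul]

theorem mulOp_add (h k : C(Circle, ℂ)) (f : Lp X 2 ν) :
    mulOp ν (h + k) f = mulOp ν h f + mulOp ν k f := by
  apply Lp.ext
  filter_upwards [coeFn_mulOp ν (h + k) f, coeFn_mulOp ν k f, coeFn_mulOp ν h f,
    Lp.coeFn_add (mulOp ν h f) (mulOp ν k f)] with z h1 h2 h3 h4
  rw [h1, h4, Pi.add_apply, h2, h3, ContinuousMap.add_apply, add_smul]

theorem mulOp_smul (c : ℂ) (h : C(Circle, ℂ)) (f : Lp X 2 ν) :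
    mulOp ν (c • h) f = c • mulOp ν h f := by
  apply Lp.ext
  filter_upwards [coeFn_mulOp ν (c • h) f, coeFn_mulOp ν h f,
    Lp.coeFn_smul c (mulOp ν h f)] with z h1 h2 h3
  rw [h1, h3, Pi.smul_apply, h2, ContinuousMap.smul_apply, smul_assoc]

theorem norm_mulOp_le (h : C(Circle, ℂ)) (f : Lp X 2 ν) : ‖mulOp ν h f‖ ≤ ‖h‖ * ‖f‖ :=
  ContinuousLinearMap.le_of_opNorm_le _ (LinearMap.mkContinuous_norm_le _ (norm_nonneg _) _) f

@[simp] theorem idCoord_apply (z : Circle) : idCoord z = (z : ℂ) := rfl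

theorem idCoord_mul_star : idCoord * star idCoord = 1 := by
  ext z
  simp [Complex.mul_conj, Circle.normSq_coe]

theorem norm_mulOp_idCoord (f : Lp X 2 ν) : ‖mulOp ν idCoord f‖ = ‖f‖ := by
  rw [Lp.norm_def, Lp.norm_def]
  congr 1
  apply eLpNorm_congr_norm_ae
  filter_upwards [coeFn_mulOp ν idCoord f] with z h1
  rw [h1, norm_smul, idCoord_apply, Circle.norm_coe, one_mul]

end Mul

/-! ### The commutation relation for the Clark operator -/

section Clark

variable {E : Type*} [NormedAddCommGroup E] [InnerProductSpace ℂ E]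
variable {M : ℕ∞} {d : ℕ} {μ : Measure Circle}
variable {e : HilbertBasis {n : ℕ // (n : ℕ∞) < M} ℂ E} {N : Circle → ℕ∞}

@[simp] theorem coe_mulH (h : C(Circle, ℂ)) (g : DirectIntegral μ e N) :
    (mulH μ e N h g : Lp E 2 μ) = mulOp μ h g := rfl

theorem mulH_mul (h k : C(Circle, ℂ)) (g : DirectIntegral μ e N) :
    mulH μ e N (h * k) g = mulH μ e N h (mulH μ e N k g) :=
  Subtype.ext (mulOp_mul μ h k g.1)

theorem mulH_one (g : DirectIntegral μ e N) : mulH μ e N 1 g = g :=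
  Subtype.ext (mulOp_one μ g.1)

theorem mulH_add (h k : C(Circle, ℂ)) (g : DirectIntegral μ e N) :
    mulH μ e N (h + k) g = mulH μ e N h g + mulH μ e N k g :=
  Subtype.ext (mulOp_add μ h k g.1)

theorem mulH_smul (c : ℂ) (h : C(Circle, ℂ)) (g : DirectIntegral μ e N) :
    mulH μ e N (c • h) g = c • mulH μ e N h g :=
  Subtype.ext (mulOp_smul μ c h g.1)

theorem tendsto_mulH {ι : Type*} {l : Filter ι} {p : ι → C(Circle, ℂ)} {h : C(Circle, ℂ)}
    (hp : Tendsto p l (𝓝 h)) (g : DirectIntegral μ e N) :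
    Tendsto (fun n => mulH μ e N (p n) g) l (𝓝 (mulH μ e N h g)) := by
  rw [tendsto_iff_norm_sub_tendsto_zero] at hp ⊢
  refine squeeze_zero (fun _ => norm_nonneg _) (fun n => ?_)
    (by simpa using hp.mul_const ‖g‖)
  have h1 : mulH μ e N (p n) g - mulH μ e N h g = mulH μ e N (p n - h) g := by
    rw [sub_eq_iff_eq_add, ← mulH_add, sub_add_cancel]
  rw [h1]
  exact norm_mulOp_le μ _ _

variable [CompleteSpace E]

/-- `U` is isometric, so `U*U = I`; multiplication by `ξ̄` is a right inverse of `U`, so it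
coincides with `U*`. -/
theorem unitaryOp_adjoint_apply (g : DirectIntegral μ e N) :
    unitaryOp μ e N (ContinuousLinearMap.adjoint (unitaryOp μ e N) g) = g := by
  have h1 := (ContinuousLinearMap.norm_map_iff_adjoint_comp_self (unitaryOp μ e N)).1
    fun x => norm_mulOp_idCoord μ _
  have h2 : g = unitaryOp μ e N (mulH μ e N (star idCoord) g) := by
    rw [← mulH_mul, idCoord_mul_star, mulH_one]
  have h3 := DFunLike.congr_fun h1 (mulH μ e N (star idCoord) g)
  rw [ContinuousLinearMap.comp_apply, ← h2] at h3
  rw [h3, h2]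
  congr 1
  rw [← h2]
  rfl

theorem adjB_apply (B : Cd d →ₗᵢ[ℂ] DirectIntegral μ e N) (x : Cd d) : adjB B (B x) = x := by
  have h1 := (ContinuousLinearMap.norm_map_iff_adjoint_comp_self B.toContinuousLinearMap).1
    B.norm_map
  exact DFunLike.congr_fun h1 x

variable {θ : Circle → (Cd d →L[ℂ] Cd d)} {S : Transcription θ}

/-- Where the compression of multiplication by `z` preserves the norm, it is the
multiplication itself. -/
theorem coe_modelOp_of_norm_eq (f : S.modelSpace) (hf : ‖S.modelOp f‖ = ‖f‖) :
    (S.modelOp f : Lp (Cdd d) 2 arcMeasure) = mulOp arcMeasure idCoord f := by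
  have h1 : mulOp arcMeasure idCoord (f : Lp (Cdd d) 2 arcMeasure) ∈ S.modelSpace := by
    -- An orthogonal projection preserves the norm of a vector only if the vector already lies in
    -- the subspace.
    rw [Submodule.mem_iff_norm_starProjection, norm_mulOp_idCoord]
    exact hf
  exact Submodule.starProjection_eq_self_iff.2 h1

variable {B : Cd d →ₗᵢ[ℂ] DirectIntegral μ e N} {Γ : Cd d →L[ℂ] Cd d}
  {C : Cd d ≃ₗᵢ[ℂ] defectSpace S.modelOp}
  {Cs : Cd d ≃ₗᵢ[ℂ] defectSpace (ContinuousLinearMap.adjoint S.modelOp)}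
  {Φ : S.modelSpace ≃ₗᵢ[ℂ] DirectIntegral μ e N}

/-- The correction term of `T` vanishes at `x`, so `Tx = Ux` has the norm of `x`; by the
intertwining the model operator preserves the norm of `Φ*x`. -/
theorem symm_unitaryOp_of_adjB_eq_zero (hΦ : IsClarkOperator S (perturbation B Γ) Φ)
    (x : DirectIntegral μ e N) (hx : adjB B (unitaryOp μ e N x) = 0) :
    (Φ.symm (unitaryOp μ e N x) : Lp (Cdd d) 2 arcMeasure) =
      mulOp arcMeasure idCoord (Φ.symm x : Lp (Cdd d) 2 arcMeasure) := by
  have h1 : Φ (S.modelOp (Φ.symm x)) = unitaryOp μ e N x := by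
    rw [hΦ, Φ.apply_symm_apply, perturbation]
    simp [hx]
  have h2 : S.modelOp (Φ.symm x) = Φ.symm (unitaryOp μ e N x) := by
    rw [← h1, Φ.symm_apply_apply]
  rw [← h2]
  apply coe_modelOp_of_norm_eq
  rw [h2, Φ.symm.norm_map, Φ.symm.norm_map]
  exact norm_mulOp_idCoord μ _

theorem unitaryOp_adjoint_adjB_comp (v : Cd d) :
    unitaryOp μ e N (ContinuousLinearMap.adjoint (adjB B ∘L unitaryOp μ e N) v) = B v := by
  have h1 : ContinuousLinearMap.adjoint (adjB B) = B.toContinuousLinearMap := by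
    rw [adjB, ContinuousLinearMap.adjoint_adjoint]
  rw [ContinuousLinearMap.adjoint_comp, h1, ContinuousLinearMap.comp_apply]
  exact unitaryOp_adjoint_apply (B v)

/-- The vector `g - y` lies in `ker B*U`, because `B*Uy = B*Bv = v = B*Ug`. It is applied with `y =
U*Bv`, `c = Cv`, `cs = C_*v`. -/
theorem symm_unitaryOp_aux (hΦ : IsClarkOperator S (perturbation B Γ) Φ)
    (g y : DirectIntegral μ e N) (v : Cd d) (c cs : S.modelSpace)
    (hv : adjB B (unitaryOp μ e N g) = v) (hUy : unitaryOp μ e N y = B v)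
    (hc : Φ.symm y = c) (hcs : Φ.symm (B v) = cs) :
    (Φ.symm (unitaryOp μ e N g) : Lp (Cdd d) 2 arcMeasure) =
      mulOp arcMeasure idCoord (Φ.symm g : Lp (Cdd d) 2 arcMeasure) +
        ((cs : Lp (Cdd d) 2 arcMeasure) -
          mulOp arcMeasure idCoord (c : Lp (Cdd d) 2 arcMeasure)) := by
  have hU : unitaryOp μ e N (g - y) = unitaryOp μ e N g - B v := by
    rw [← hUy]
    exact ContinuousLinearMap.map_sub _ _ _
  have h0 : adjB B (unitaryOp μ e N (g - y)) = 0 := by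
    rw [hU, ContinuousLinearMap.map_sub, adjB_apply, hv, sub_self]
  have h1 := symm_unitaryOp_of_adjB_eq_zero hΦ (g - y) h0
  have h2 : (Φ.symm (unitaryOp μ e N g - B v) : Lp (Cdd d) 2 arcMeasure) =
      Φ.symm (unitaryOp μ e N g) - (cs : Lp (Cdd d) 2 arcMeasure) := by
    rw [LinearIsometryEquiv.map_sub, hcs, Submodule.coe_sub]
  have h3 : (Φ.symm (g - y) : Lp (Cdd d) 2 arcMeasure) =
      Φ.symm g - (c : Lp (Cdd d) 2 arcMeasure) := by
    rw [LinearIsometryEquiv.map_sub, hc, Submodule.coe_sub]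
  rw [hU, h2, h3, ContinuousLinearMap.map_sub, sub_eq_iff_eq_add] at h1
  rw [h1]
  abel

/-- The commutation relation `Φ* U = M_z Φ* + (C_* - M_z C) B* U`. -/
theorem symm_unitaryOp (hΦ : IsClarkOperator S (perturbation B Γ) Φ)
    (hagree : AgreesVia S B Φ C Cs) (g u : DirectIntegral μ e N)
    (hu : unitaryOp μ e N g = u) :
    (Φ.symm u : Lp (Cdd d) 2 arcMeasure) =
      mulOp arcMeasure idCoord (Φ.symm g : Lp (Cdd d) 2 arcMeasure) +
        (((Cs (adjB B u) : S.modelSpace) : Lp (Cdd d) 2 arcMeasure) -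
          mulOp arcMeasure idCoord
            ((C (adjB B u) : S.modelSpace) : Lp (Cdd d) 2 arcMeasure)) := by
  subst hu
  exact symm_unitaryOp_aux hΦ g _ _ _ _ rfl (unitaryOp_adjoint_adjB_comp _) (hagree.1 _)
    (hagree.2 _)

end Clark

/-! ### Representatives in the weighted space -/

section Weight

variable {d : ℕ} {W : Circle → (Cdd d →L[ℂ] Cdd d)} {f f' : Circle → Cdd d}
  {g g' : Lp (Cdd d) 2 arcMeasure}

theorem Represents.add (h : Represents W f g) (h' : Represents W f' g') :
    Represents W (fun z => f z + f' z) (g + g') := by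
  refine ⟨h.1.add h'.1, ?_⟩
  filter_upwards [h.2, h'.2, Lp.coeFn_add g g'] with z a b c
  rw [c, Pi.add_apply, map_add, a, b]

theorem Represents.sub (h : Represents W f g) (h' : Represents W f' g') :
    Represents W (fun z => f z - f' z) (g - g') := by
  refine ⟨h.1.sub h'.1, ?_⟩
  filter_upwards [h.2, h'.2, Lp.coeFn_sub g g'] with z a b c
  rw [c, Pi.sub_apply, map_sub, a, b]

theorem Represents.smul (c : ℂ) (h : Represents W f g) :
    Represents W (fun z => c • f z) (c • g) := by
  refine ⟨h.1.const_smul c, ?_⟩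
  filter_upwards [h.2, Lp.coeFn_smul c g] with z a b
  rw [b, Pi.smul_apply, map_smul, a]

theorem Represents.mulOp (k : C(Circle, ℂ)) (h : Represents W f g) :
    Represents W (fun z => k z • f z) (mulOp arcMeasure k g) := by
  refine ⟨k.continuous.aestronglyMeasurable.smul h.1, ?_⟩
  filter_upwards [h.2, coeFn_mulOp arcMeasure k g] with z a b
  rw [b, map_smul, a]

theorem Represents.congr (h : Represents W f g) (hf : f =ᵐ[arcMeasure] f') :
    Represents W f' g := by
  refine ⟨h.1.congr hf, ?_⟩
  filter_upwards [h.2, hf] with z a b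
  rw [← b, a]

/-- Elements of the weighted space whose representatives converge pointwise. -/
theorem Represents.of_tendsto {F : ℕ → Circle → Cdd d} {G : ℕ → Lp (Cdd d) 2 arcMeasure}
    (h : ∀ n, Represents W (F n) (G n))
    (hF : ∀ᵐ z ∂arcMeasure, Tendsto (fun n => F n z) atTop (𝓝 (f z)))
    (hG : Tendsto G atTop (𝓝 g)) : Represents W f g := by
  refine ⟨aestronglyMeasurable_of_tendsto_ae atTop (fun n => (h n).1) hF, ?_⟩
  -- Norm convergence gives a.e. convergence along a subsequence; there the two limits are compared
  -- fibrewise through the continuous operator `W(z)^{1/2}`.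
  obtain ⟨ns, hns, hlim⟩ := (tendstoInMeasure_of_tendsto_Lp hG).exists_seq_tendsto_ae
  filter_upwards [hF, hlim, ae_all_iff.2 fun n => (h n).2] with z h1 h2 h3
  refine tendsto_nhds_unique ?_ h2
  simp only [← h3]
  exact (((CFC.sqrt (W z)).continuous.tendsto (f z)).comp h1).comp hns.tendsto_atTop

end Weight

/-! ### Trigonometric polynomials and `C¹` approximation -/

section TrigonometricApproximation

/-- The character `z ↦ z ^ n` of the circle. -/
def character (n : ℤ) : C(Circle, ℂ) :=
  ⟨fun z => ((z ^ n : Circle) : ℂ), continuous_induced_dom.comp (continuous_zpow n)⟩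

@[simp] theorem character_apply (n : ℤ) (z : Circle) : character n z = (z : ℂ) ^ n :=
  Circle.coe_zpow z n

theorem character_add_one (n : ℤ) : character (n + 1) = idCoord * character n := by
  ext z
  simp [zpow_add_one₀ z.coe_ne_zero, mul_comm]

theorem character_zero : character 0 = 1 := by
  ext z
  simp

theorem character_exp (n : ℤ) (t : ℝ) :
    character n (Circle.exp t) = Complex.exp (n * Complex.I * t) := by
  rw [character_apply, Circle.coe_exp, ← Complex.exp_int_mul]
  congr 1
  ring

theorem hasDerivAt_character_exp (n : ℤ) (t : ℝ) :
    HasDerivAt (fun t : ℝ => character n (Circle.exp t))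
      (n * Complex.I * character n (Circle.exp t)) t := by
  simp only [character_exp]
  have h1 : HasDerivAt (fun s : ℂ => Complex.exp (n * Complex.I * s))
      (Complex.exp (n * Complex.I * t) * (n * Complex.I * 1)) (t : ℂ) :=
    ((hasDerivAt_id (t : ℂ)).const_mul (n * Complex.I)).cexp
  have h2 := h1.comp_ofReal
  rw [mul_one, mul_comm (Complex.exp _)] at h2
  exact h2

theorem fourier_two_pi_coe (n : ℤ) (t : ℝ) :
    fourier n (t : AddCircle (2 * Real.pi)) = character n (Circle.exp t) := by
  rw [fourier_coe_apply, character_exp]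
  congr 1
  have : (Real.pi : ℂ) ≠ 0 := by exact_mod_cast Real.pi_ne_zero
  push_cast
  field_simp

/-- A function on the circle whose angular derivative is bounded by `K` is Lipschitz with
constant `K π / 2` in the chordal metric. -/
theorem norm_sub_le_chord_of_hasDerivAt {F : Circle → ℂ} {F' : ℝ → ℂ} {K : ℝ}
    (hF : ∀ t : ℝ, HasDerivAt (fun t : ℝ => F (Circle.exp t)) (F' t) t)
    (hK : ∀ t, ‖F' t‖ ≤ K) (ξ z : Circle) :
    ‖F ξ - F z‖ ≤ K * (Real.pi / 2) * ‖(ξ : ℂ) - z‖ := by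
  set t := Complex.arg z with ht
  set s := Complex.arg ((ξ / z : Circle) : ℂ) with hs
  have hz : Circle.exp t = z := Circle.exp_arg z
  have hξ : Circle.exp (t + s) = ξ := by
    rw [Circle.exp_add, hz, hs, Circle.exp_arg, mul_div_cancel]
  have hK0 : 0 ≤ K := (norm_nonneg _).trans (hK 0)
  have h1 : ‖F ξ - F z‖ ≤ K * |s| := by
    have := convex_univ.norm_image_sub_le_of_norm_hasDerivWithin_le
      (fun x _ => (hF x).hasDerivWithinAt) (fun x _ => hK x) (Set.mem_univ t)
      (Set.mem_univ (t + s))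
    simpa only [hz, hξ, add_sub_cancel_left, Real.norm_eq_abs] using this
  have h2 : ‖(ξ : ℂ) - z‖ = 2 * |Real.sin (s / 2)| := by
    have h3 : (ξ : ℂ) - z = z * (Complex.exp (Complex.I * s) - 1) := by
      conv_lhs => rw [← hξ, Circle.exp_add, hz, Circle.coe_mul, Circle.coe_exp]
      rw [mul_comm Complex.I]
      ring
    rw [h3, norm_mul, Circle.norm_coe, one_mul, Complex.norm_exp_I_mul_ofReal_sub_one,
      norm_mul, Real.norm_eq_abs, Real.norm_eq_abs, abs_two]
  -- Jordan's inequality applies because `s` is a principal argument, so `|s/2| ≤ π/2`.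
  have h4 : 2 / Real.pi * |s / 2| ≤ |Real.sin (s / 2)| := by
    apply Real.mul_abs_le_abs_sin
    rw [abs_div, abs_two]
    exact div_le_div_of_nonneg_right (Complex.abs_arg_le_pi _) zero_le_two
  have h5 : |s| ≤ Real.pi / 2 * ‖(ξ : ℂ) - z‖ := by
    rw [h2]
    have hp := Real.pi_pos
    rw [abs_div, abs_two] at h4
    calc |s| = Real.pi * (2 / Real.pi * (|s| / 2)) := by field_simp
      _ ≤ Real.pi * |Real.sin (s / 2)| := mul_le_mul_of_nonneg_left h4 hp.le
      _ = _ := by ring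
  calc ‖F ξ - F z‖ ≤ K * |s| := h1
    _ ≤ K * (Real.pi / 2 * ‖(ξ : ℂ) - z‖) := mul_le_mul_of_nonneg_left h5 hK0
    _ = _ := by ring

/-- A trigonometric polynomial is, up to its constant term, the angular derivative of a
trigonometric polynomial. -/
theorem exists_primitive_of_mem_span_fourier (q : C(AddCircle (2 * Real.pi), ℂ))
    (hq : q ∈ Submodule.span ℂ (Set.range (@fourier (2 * Real.pi)))) :
    ∃ p ∈ Submodule.span ℂ (Set.range character), ∃ c : ℂ, ∀ t : ℝ,
      HasDerivAt (fun t : ℝ => p (Circle.exp t)) (q (t : AddCircle (2 * Real.pi)) - c) t := by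
  induction hq using Submodule.span_induction with
  | mem q hq =>
    obtain ⟨n, rfl⟩ := hq
    rcases eq_or_ne n 0 with rfl | hn
    -- The constant character has no periodic primitive; it is absorbed entirely by the constant
    -- `c`.
    · refine ⟨0, Submodule.zero_mem _, 1, fun t => ?_⟩
      rw [fourier_two_pi_coe]
      simpa using hasDerivAt_const t (0 : ℂ)
    · refine ⟨(n * Complex.I)⁻¹ • character n,
        Submodule.smul_mem _ _ (Submodule.subset_span ⟨n, rfl⟩), 0, fun t => ?_⟩
      have h1 := (hasDerivAt_character_exp n t).const_mul (n * Complex.I)⁻¹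
      have hn' : (n : ℂ) * Complex.I ≠ 0 :=
        mul_ne_zero (Int.cast_ne_zero.2 hn) Complex.I_ne_zero
      rw [inv_mul_cancel_left₀ hn'] at h1
      rw [fourier_two_pi_coe, sub_zero]
      exact h1
  | zero => exact ⟨0, Submodule.zero_mem _, 0, fun t => by simpa using hasDerivAt_const t (0 : ℂ)⟩
  | add q q' _ _ hq hq' =>
    obtain ⟨p, hp, c, h⟩ := hq
    obtain ⟨p', hp', c', h'⟩ := hq'
    refine ⟨p + p', Submodule.add_mem _ hp hp', c + c', fun t => ?_⟩
    have := (h t).add (h' t)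
    rw [ContinuousMap.add_apply, add_sub_add_comm]
    exact this
  | smul a q _ hq =>
    obtain ⟨p, hp, c, h⟩ := hq
    refine ⟨a • p, Submodule.smul_mem _ _ hp, a • c, fun t => ?_⟩
    have := (h t).const_smul a
    rw [ContinuousMap.smul_apply, ← smul_sub]
    exact this

/-- Trigonometric polynomials are dense in `C¹` of the circle. -/
theorem exists_trigonometric_approx (h : C(Circle, ℂ))
    (hh : ContDiff ℝ 1 fun t : ℝ => h (Circle.exp t)) {ε : ℝ} (hε : 0 < ε) :
    ∃ p ∈ Submodule.span ℂ (Set.range character), ‖p - h‖ ≤ ε ∧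
      ∀ ξ z : Circle, ‖(p - h) ξ - (p - h) z‖ ≤ ε * ‖(ξ : ℂ) - z‖ := by
  set g : ℝ → ℂ := fun t => h (Circle.exp t) with hg
  have hper : Function.Periodic g (2 * Real.pi) := fun t => by
    simp only [hg, Circle.periodic_exp t]
  have hg' : Continuous (deriv g) := hh.continuous_deriv le_rfl
  have hperd : Function.Periodic (deriv g) (2 * Real.pi) := fun t => by
    rw [← deriv_comp_add_const]
    congr 1
    exact funext hper
  have hder : ∀ t, HasDerivAt g (deriv g t) t := fun t =>
    (hh.differentiable one_ne_zero t).hasDerivAt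
  let G : C(AddCircle (2 * Real.pi), ℂ) :=
    ⟨hperd.lift, continuous_coinduced_dom.2 hg'⟩
  have hG : ∀ t : ℝ, G (t : AddCircle (2 * Real.pi)) = deriv g t := fun t => rfl
  have : Fact (0 < 2 * Real.pi) := ⟨Real.two_pi_pos⟩
  -- The angular derivative of the error will be at most `2δ`; the factor `π/2` converts it to a
  -- chordal Lipschitz constant, and the last `2` is the diameter of the circle, needed for the sup
  -- norm.
  obtain ⟨δ, hδ, hδε⟩ : ∃ δ : ℝ, 0 < δ ∧ 2 * δ * (Real.pi / 2) * 2 ≤ ε := by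
    have hp := Real.pi_pos
    refine ⟨ε / (2 * Real.pi), by positivity, le_of_eq (by field_simp)⟩
  have hmem : G ∈ (Submodule.span ℂ (Set.range (@fourier (2 * Real.pi)))).topologicalClosure := by
    rw [span_fourier_closure_eq_top]
    trivial
  obtain ⟨q, hq, hqG⟩ := Metric.mem_closure_iff.1 hmem δ hδ
  obtain ⟨p, hp, c, hpc⟩ := exists_primitive_of_mem_span_fourier q hq
  have hqg : ∀ t : ℝ, ‖q (t : AddCircle (2 * Real.pi)) - deriv g t‖ ≤ δ := fun t => by
    rw [← hG, ← dist_eq_norm, dist_comm]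
    exact (ContinuousMap.dist_apply_le_dist _).trans hqG.le
  have hD : ∀ t : ℝ, HasDerivAt (fun t : ℝ => (p - h) (Circle.exp t))
      (q (t : AddCircle (2 * Real.pi)) - c - deriv g t) t := fun t => (hpc t).sub (hder t)
  have hcont : Continuous fun t : ℝ => q (t : AddCircle (2 * Real.pi)) - deriv g t :=
    (q.continuous.comp (AddCircle.continuous_mk' _)).sub hg'
  -- The derivative of the periodic function `p - h` integrates to `0` over a period, so `c` is the
  -- mean of `q - h'`, which is at most `δ` in modulus.
  have hc : ‖c‖ ≤ δ := by
    have h0 : ∫ t in (0 : ℝ)..(2 * Real.pi),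
        (q (t : AddCircle (2 * Real.pi)) - c - deriv g t) = 0 := by
      rw [intervalIntegral.integral_eq_sub_of_hasDerivAt (fun t _ => hD t)]
      · rw [Circle.exp_two_pi, Circle.exp_zero, sub_self]
      · refine Continuous.intervalIntegrable ?_ _ _
        exact ((q.continuous.comp (AddCircle.continuous_mk' _)).sub continuous_const).sub hg'
    have h1 : ∫ t in (0 : ℝ)..(2 * Real.pi), (q (t : AddCircle (2 * Real.pi)) - deriv g t) =
        (2 * Real.pi : ℝ) • c := by
      have h2 : (fun t : ℝ => q (t : AddCircle (2 * Real.pi)) - c - deriv g t) =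
          fun t : ℝ => (q (t : AddCircle (2 * Real.pi)) - deriv g t) - c := by
        ext t
        ring
      rw [h2, intervalIntegral.integral_sub (hcont.intervalIntegrable _ _)
        (by simp), intervalIntegral.integral_const, sub_zero, sub_eq_zero] at h0
      exact h0
    have h3 := intervalIntegral.norm_integral_le_of_norm_le_const (a := 0) (b := 2 * Real.pi)
      fun t _ => hqg t
    rw [h1, norm_smul, Real.norm_eq_abs, sub_zero, mul_comm] at h3
    exact le_of_mul_le_mul_right h3 (abs_pos.2 Real.two_pi_pos.ne')
  have hbound : ∀ t : ℝ, ‖q (t : AddCircle (2 * Real.pi)) - c - deriv g t‖ ≤ 2 * δ := fun t => by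
    have h1 : q (t : AddCircle (2 * Real.pi)) - c - deriv g t =
        (q (t : AddCircle (2 * Real.pi)) - deriv g t) - c := by ring
    rw [h1]
    refine le_of_le_of_eq ?_ (two_mul δ).symm
    exact (norm_sub_le _ _).trans (add_le_add (hqg t) hc)
  have hLip := norm_sub_le_chord_of_hasDerivAt hD hbound
  have hK0 : 0 ≤ 2 * δ * (Real.pi / 2) := by
    have := Real.pi_pos
    positivity
  have hLipε : ∀ ξ z : Circle, ‖(p - h) ξ - (p - h) z‖ ≤ ε * ‖(ξ : ℂ) - z‖ := fun ξ z =>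
    (hLip ξ z).trans (mul_le_mul_of_nonneg_right (by linarith) (norm_nonneg _))
  -- Subtracting a constant makes the error vanish at `1`, so its Lipschitz bound also controls its
  -- sup norm.
  refine ⟨p - (p - h) 1 • character 0, Submodule.sub_mem _ hp
    (Submodule.smul_mem _ _ (Submodule.subset_span ⟨0, rfl⟩)), ?_, fun ξ z => ?_⟩
  · refine (ContinuousMap.norm_le _ hε.le).2 fun ξ => ?_
    have h1 : (p - (p - h) 1 • character 0 - h) ξ = (p - h) ξ - (p - h) 1 := by
      simp
      ring
    rw [h1]
    refine (hLip ξ 1).trans (le_trans (mul_le_mul_of_nonneg_left ?_ hK0) hδε)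
    refine (norm_sub_le _ _).trans ?_
    rw [Circle.norm_coe, Circle.norm_coe]
    norm_num
  · have h1 : (p - (p - h) 1 • character 0 - h) ξ - (p - (p - h) 1 • character 0 - h) z =
        (p - h) ξ - (p - h) z := by
      simp
      ring
    rw [h1]
    exact hLipε ξ z

end TrigonometricApproximation

/-! ### Atoms are negligible for `m` -/

section Atoms

instance instNullSingletonClassArcMeasure : NullSingletonClass arcMeasure := by
  refine ⟨fun z => ?_⟩
  rw [arcMeasure, Measure.smul_apply,
    Measure.map_apply Circle.exp.continuous.measurable (measurableSet_singleton z),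
    Measure.restrict_apply (Circle.exp.continuous.measurable (measurableSet_singleton z))]
  have h1 : (Circle.exp ⁻¹' {z} ∩ Set.Ioc 0 (2 * Real.pi)).Subsingleton := by
    rintro s ⟨hs, hs'⟩ t ⟨ht, ht'⟩
    exact Circle.exp_injOn_Ioc (by simp) hs' ht' (hs.trans ht.symm)
  rw [h1.measure_zero, smul_zero]

/-- A finite measure has at most countably many atoms. This makes the exceptional point `ξ = z` of
the kernel identity harmless for almost every `z`. -/
theorem ae_measure_singleton_eq_zero (μ : Measure Circle) [IsFiniteMeasure μ] :
    ∀ᵐ z ∂arcMeasure, μ {z} = 0 := by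
  have h1 : {z : Circle | 0 < μ {a | id a = z}}.Countable :=
    Measure.countable_meas_level_set_pos measurable_id
  filter_upwards [measure_eq_zero_iff_ae_notMem.1 (h1.measure_zero arcMeasure)] with z hz
  exact nonpos_iff_eq_zero.1 (not_lt.1 hz)

end Atoms

/-! ### The difference-quotient kernel -/

section ChordQuotient

/-- The kernel `(h(ξ) - h(z)) / (1 - z ξ̄)`. -/
def chordQuotient (h : C(Circle, ℂ)) (z ξ : Circle) : ℂ :=
  (h ξ - h z) / (1 - (z : ℂ) * conj (ξ : ℂ))

/-- `h` is Lipschitz in the chordal metric, with constant `K`. -/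
def ChordLipschitz (K : ℝ) (h : C(Circle, ℂ)) : Prop :=
  ∀ ξ z : Circle, ‖h ξ - h z‖ ≤ K * ‖(ξ : ℂ) - z‖

theorem coe_mul_conj (z : Circle) : (z : ℂ) * conj (z : ℂ) = 1 := by
  simp [Complex.mul_conj, Circle.normSq_coe]

theorem one_sub_mul_conj_mul (z ξ : Circle) :
    (1 - (z : ℂ) * conj (ξ : ℂ)) * ξ = ξ - z := by
  linear_combination (-(z : ℂ)) * coe_mul_conj ξ

theorem norm_one_sub_mul_conj (z ξ : Circle) :
    ‖1 - (z : ℂ) * conj (ξ : ℂ)‖ = ‖(ξ : ℂ) - z‖ := by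
  rw [← one_sub_mul_conj_mul, norm_mul, Circle.norm_coe, mul_one]

theorem norm_chordQuotient_le {K : ℝ} (hK : 0 ≤ K) {h : C(Circle, ℂ)} (hh : ChordLipschitz K h)
    (z ξ : Circle) : ‖chordQuotient h z ξ‖ ≤ K := by
  rw [chordQuotient, norm_div, norm_one_sub_mul_conj]
  -- At `ξ = z` the quotient is `0 / 0 = 0`, so the bound persists there since `0 ≤ K`.
  exact div_le_of_le_mul₀ (norm_nonneg _) hK (hh ξ z)

theorem measurable_chordQuotient (h : C(Circle, ℂ)) (z : Circle) :
    Measurable (chordQuotient h z) := by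
  have h1 : Continuous fun ξ : Circle => conj (ξ : ℂ) :=
    Complex.continuous_conj.comp continuous_induced_dom
  exact (h.continuous.sub continuous_const).measurable.div
    (continuous_const.sub (continuous_const.mul h1)).measurable

theorem chordQuotient_add (h k : C(Circle, ℂ)) (z ξ : Circle) :
    chordQuotient (h + k) z ξ = chordQuotient h z ξ + chordQuotient k z ξ := by
  simp only [chordQuotient, ContinuousMap.add_apply]
  rw [add_sub_add_comm, add_div]

theorem chordQuotient_smul (c : ℂ) (h : C(Circle, ℂ)) (z ξ : Circle) :
    chordQuotient (c • h) z ξ = c * chordQuotient h z ξ := by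
  simp only [chordQuotient, ContinuousMap.smul_apply, smul_eq_mul]
  rw [← mul_sub, mul_div_assoc]

/-- Split `ξh(ξ) - zh(z) = z(h(ξ) - h(z)) + (ξ - z)h(ξ)` and use `ξ - z = (1 - zξ̄)ξ`. At `ξ = z`
both quotients take the value `0` and the extra term `zh(z)` need not vanish. -/
theorem chordQuotient_idCoord_mul (h : C(Circle, ℂ)) {z ξ : Circle} (hne : ξ ≠ z) :
    chordQuotient (idCoord * h) z ξ = z * chordQuotient h z ξ + (idCoord * h) ξ := by
  have h1 : (1 - (z : ℂ) * conj (ξ : ℂ)) ≠ 0 := by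
    rw [← norm_ne_zero_iff, norm_one_sub_mul_conj, norm_ne_zero_iff, sub_ne_zero]
    exact fun h => hne (Circle.ext h)
  simp only [chordQuotient, ContinuousMap.mul_apply, idCoord_apply]
  rw [div_eq_iff h1, add_mul, mul_assoc (z : ℂ), div_mul_cancel₀ _ h1]
  linear_combination (-h ξ) * one_sub_mul_conj_mul z ξ

theorem ChordLipschitz.add {K L : ℝ} {h k : C(Circle, ℂ)} (hh : ChordLipschitz K h)
    (hk : ChordLipschitz L k) : ChordLipschitz (K + L) (h + k) := fun ξ z => by
  rw [ContinuousMap.add_apply, ContinuousMap.add_apply, add_sub_add_comm, add_mul]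
  exact (norm_add_le _ _).trans (add_le_add (hh ξ z) (hk ξ z))

theorem ChordLipschitz.smul {K : ℝ} {h : C(Circle, ℂ)} (c : ℂ) (hh : ChordLipschitz K h) :
    ChordLipschitz (‖c‖ * K) (c • h) := fun ξ z => by
  rw [ContinuousMap.smul_apply, ContinuousMap.smul_apply, ← smul_sub, norm_smul, mul_assoc]
  exact mul_le_mul_of_nonneg_left (hh ξ z) (norm_nonneg c)

theorem chordLipschitz_character (n : ℤ) :
    ChordLipschitz (‖(n : ℂ)‖ * (Real.pi / 2)) (character n) :=
  norm_sub_le_chord_of_hasDerivAt (hasDerivAt_character_exp n) fun t => by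
    rw [norm_mul, norm_mul, Complex.norm_I, mul_one, character_apply, norm_zpow, Circle.norm_coe,
      one_zpow, mul_one]

/-- Trigonometric polynomials are Lipschitz. -/
theorem exists_chordLipschitz_of_mem_span (p : C(Circle, ℂ))
    (hp : p ∈ Submodule.span ℂ (Set.range character)) : ∃ K, 0 ≤ K ∧ ChordLipschitz K p := by
  induction hp using Submodule.span_induction with
  | mem p hp =>
    obtain ⟨n, rfl⟩ := hp
    have := Real.pi_pos
    exact ⟨_, by positivity, chordLipschitz_character n⟩
  | zero => exact ⟨0, le_rfl, fun ξ z => by simp⟩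
  | add p q _ _ hp hq =>
    obtain ⟨K, hK, hp⟩ := hp
    obtain ⟨L, hL, hq⟩ := hq
    exact ⟨_, add_nonneg hK hL, hp.add hq⟩
  | smul c p _ hp =>
    obtain ⟨K, hK, hp⟩ := hp
    exact ⟨_, mul_nonneg (norm_nonneg c) hK, hp.smul c⟩

end ChordQuotient

/-! ### The functions `B*(ξ)b(ξ)` and their integrals -/

section FiberAdjoint

variable {E : Type*} [NormedAddCommGroup E] [InnerProductSpace ℂ E]
variable {M : ℕ∞} {d : ℕ} {μ : Measure Circle}
variable {e : HilbertBasis {n : ℕ // (n : ℕ∞) < M} ℂ E} {N : Circle → ℕ∞}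
variable (B : Cd d →ₗᵢ[ℂ] DirectIntegral μ e N) (b : DirectIntegral μ e N)

theorem integrable_fiberAdj : Integrable (fiberAdj B b) μ :=
  Integrable.of_eval_piLp fun _ => L2.integrable_inner _ _

theorem fiberAdj_mulH (h : C(Circle, ℂ)) :
    fiberAdj B (mulH μ e N h b) =ᵐ[μ] fun ξ => h ξ • fiberAdj B b ξ := by
  filter_upwards [coeFn_mulOp μ h (b : Lp E 2 μ)] with ξ hξ
  ext k
  simp [fiberAdj, hξ]

/-- The integral `∫ (h(ξ) - h(z)) / (1 - z ξ̄) B*(ξ) b(ξ) dμ(ξ)`. -/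
def chordIntegral (h : C(Circle, ℂ)) (z : Circle) : Cd d :=
  ∫ ξ, chordQuotient h z ξ • fiberAdj B b ξ ∂μ

theorem integrable_chordQuotient_smul {K : ℝ} (hK : 0 ≤ K) {h : C(Circle, ℂ)}
    (hh : ChordLipschitz K h) (z : Circle) :
    Integrable (fun ξ => chordQuotient h z ξ • fiberAdj B b ξ) μ :=
  (integrable_fiberAdj B b).bdd_smul K (measurable_chordQuotient h z).aestronglyMeasurable
    (Eventually.of_forall fun ξ => norm_chordQuotient_le hK hh z ξ)

theorem norm_chordIntegral_le {K : ℝ} (hK : 0 ≤ K) {h : C(Circle, ℂ)}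
    (hh : ChordLipschitz K h) (z : Circle) :
    ‖chordIntegral B b h z‖ ≤ K * ∫ ξ, ‖fiberAdj B b ξ‖ ∂μ := by
  rw [← integral_const_mul]
  refine norm_integral_le_of_norm_le ((integrable_fiberAdj B b).norm.const_mul K)
    (Eventually.of_forall fun ξ => ?_)
  rw [norm_smul]
  exact mul_le_mul_of_nonneg_right (norm_chordQuotient_le hK hh z ξ) (norm_nonneg _)

theorem chordIntegral_add {K L : ℝ} (hK : 0 ≤ K) (hL : 0 ≤ L) {h k : C(Circle, ℂ)}
    (hh : ChordLipschitz K h) (hk : ChordLipschitz L k) (z : Circle) :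
    chordIntegral B b (h + k) z = chordIntegral B b h z + chordIntegral B b k z := by
  rw [chordIntegral, chordIntegral, chordIntegral,
    ← integral_add (integrable_chordQuotient_smul B b hK hh z)
      (integrable_chordQuotient_smul B b hL hk z)]
  simp only [chordQuotient_add, add_smul]

theorem chordIntegral_smul (c : ℂ) (h : C(Circle, ℂ)) (z : Circle) :
    chordIntegral B b (c • h) z = c • chordIntegral B b h z := by
  rw [chordIntegral, chordIntegral, ← integral_smul]
  simp only [chordQuotient_smul, mul_smul]

theorem chordIntegral_one (z : Circle) : chordIntegral B b 1 z = 0 := by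
  simp [chordIntegral, chordQuotient]

variable [CompleteSpace E]

theorem adjB_eq_integral : adjB B b = ∫ ξ, fiberAdj B b ξ ∂μ := by
  ext k
  have h1 := (EuclideanSpace.proj (𝕜 := ℂ) k).integral_comp_comm (integrable_fiberAdj B b)
  have h2 : (∫ ξ, fiberAdj B b ξ ∂μ) k = ∫ ξ, (fiberAdj B b ξ) k ∂μ := h1.symm
  rw [h2]
  have h3 : (adjB B b) k = inner ℂ (EuclideanSpace.single k (1 : ℂ)) (adjB B b) := by
    simp [EuclideanSpace.inner_single_left]
  rw [h3, adjB, ContinuousLinearMap.adjoint_inner_right, Submodule.coe_inner, L2.inner_def]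
  rfl

/-- The kernel identity is integrated against `B*(ξ)b(ξ)`; its extra term `ξh(ξ)` produces
`B*(ξhb)`, which is the `B*U` term of the commutation relation. -/
theorem chordIntegral_idCoord_mul {K : ℝ} (hK : 0 ≤ K) {h : C(Circle, ℂ)}
    (hh : ChordLipschitz K h) {z : Circle} (hz : μ {z} = 0) :
    chordIntegral B b (idCoord * h) z =
      (z : ℂ) • chordIntegral B b h z + adjB B (mulH μ e N (idCoord * h) b) := by
  rw [adjB_eq_integral, chordIntegral, chordIntegral, ← integral_smul]
  refine Eq.trans (integral_congr_ae ?_) (integral_add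
    ((integrable_chordQuotient_smul B b hK hh z).smul (z : ℂ)) (integrable_fiberAdj B _))
  filter_upwards [fiberAdj_mulH B b (idCoord * h), measure_eq_zero_iff_ae_notMem.1 hz]
    with ξ h1 h2
  simp only [h1, chordQuotient_idCoord_mul h h2, add_smul, mul_smul]

end FiberAdjoint

/-! ### The representation formula: monomials, polynomials, `C¹` functions -/

section Representation

variable {E : Type*} [NormedAddCommGroup E] [InnerProductSpace ℂ E] [CompleteSpace E]
variable {M : ℕ∞} {d : ℕ} {μ : Measure Circle}
variable {e : HilbertBasis {n : ℕ // (n : ℕ∞) < M} ℂ E} {N : Circle → ℕ∞}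
variable (B : Cd d →ₗᵢ[ℂ] DirectIntegral μ e N) (b : DirectIntegral μ e N)
variable (Cfun Csfun : Circle → (Cd d →L[ℂ] Cdd d))

/-- The function representing `Φ* (h b)`. -/
def clarkRepr (h : C(Circle, ℂ)) (z : Circle) : Cdd d :=
  h z • Csfun z (adjB B b) + (Csfun z - (z : ℂ) • Cfun z) (chordIntegral B b h z)

theorem clarkRepr_add {K L : ℝ} (hK : 0 ≤ K) (hL : 0 ≤ L) {h k : C(Circle, ℂ)}
    (hh : ChordLipschitz K h) (hk : ChordLipschitz L k) (z : Circle) :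
    clarkRepr B b Cfun Csfun (h + k) z =
      clarkRepr B b Cfun Csfun h z + clarkRepr B b Cfun Csfun k z := by
  simp only [clarkRepr, chordIntegral_add B b hK hL hh hk, map_add, ContinuousMap.add_apply,
    add_smul]
  abel

theorem clarkRepr_smul (c : ℂ) (h : C(Circle, ℂ)) (z : Circle) :
    clarkRepr B b Cfun Csfun (c • h) z = c • clarkRepr B b Cfun Csfun h z := by
  simp only [clarkRepr, chordIntegral_smul, map_smul, ContinuousMap.smul_apply, smul_add,
    smul_assoc]

theorem clarkRepr_one (z : Circle) : clarkRepr B b Cfun Csfun 1 z = Csfun z (adjB B b) := by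
  simp [clarkRepr, chordIntegral_one]

theorem clarkRepr_idCoord_mul {K : ℝ} (hK : 0 ≤ K) {h : C(Circle, ℂ)}
    (hh : ChordLipschitz K h) {z : Circle} (hz : μ {z} = 0) :
    clarkRepr B b Cfun Csfun (idCoord * h) z =
      (z : ℂ) • clarkRepr B b Cfun Csfun h z +
        (Csfun z (adjB B (mulH μ e N (idCoord * h) b)) -
          (z : ℂ) • Cfun z (adjB B (mulH μ e N (idCoord * h) b))) := by
  have h1 : ∀ v, (Csfun z - (z : ℂ) • Cfun z) v = Csfun z v - (z : ℂ) • Cfun z v := fun v => rfl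
  rw [clarkRepr, clarkRepr, chordIntegral_idCoord_mul B b hK hh hz, map_add, map_smul, h1 (adjB _ _),
    smul_add, ContinuousMap.mul_apply, idCoord_apply, mul_smul, add_assoc]

variable {B b Cfun Csfun} {Γ : Cd d →L[ℂ] Cd d}
  {θ : Circle → (Cd d →L[ℂ] Cd d)} {S : Transcription θ}
  {C : Cd d ≃ₗᵢ[ℂ] defectSpace S.modelOp}
  {Cs : Cd d ≃ₗᵢ[ℂ] defectSpace (ContinuousLinearMap.adjoint S.modelOp)}
  {Φ : S.modelSpace ≃ₗᵢ[ℂ] DirectIntegral μ e N}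

/-- Multiplication by `z̄` inverts `M_z`, so the recurrence can be undone; this direction reaches
the negative powers. -/
theorem represents_iff_of_recurrence {F F' c cs : Circle → Cdd d}
    {g g' x xs : Lp (Cdd d) 2 arcMeasure} {W : Circle → (Cdd d →L[ℂ] Cdd d)}
    (hx : Represents W c x) (hxs : Represents W cs xs)
    (hg : g' = mulOp arcMeasure idCoord g + (xs - mulOp arcMeasure idCoord x))
    (hF : ∀ᵐ z ∂arcMeasure, F' z = (z : ℂ) • F z + (cs z - (z : ℂ) • c z)) :
    Represents W F' g' ↔ Represents W F g := by
  have hv := hxs.sub (hx.mulOp idCoord)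
  constructor
  · intro hr
    rw [hg] at hr
    have h1 := (hr.sub hv).mulOp (star idCoord)
    rw [add_sub_cancel_right, ← mulOp_mul, mul_comm, idCoord_mul_star, mulOp_one] at h1
    refine h1.congr ?_
    filter_upwards [hF] with z hz
    rw [hz]
    simp only [idCoord_apply, add_sub_cancel_right, smul_smul]
    have : (star idCoord : C(Circle, ℂ)) z * (z : ℂ) = 1 := by
      rw [mul_comm]
      exact coe_mul_conj z
    rw [this, one_smul]
  · intro hr
    rw [hg]
    refine ((hr.mulOp idCoord).add hv).congr ?_
    filter_upwards [hF] with z hz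
    rw [hz]
    rfl

/-- The representation formula holds for `h` iff it holds for `ξ h`. -/
theorem represents_idCoord_mul_iff [IsFiniteMeasure μ]
    (hΦ : IsClarkOperator S (perturbation B Γ) Φ) (hagree : AgreesVia S B Φ C Cs)
    (hC : IsFunctionOf S Cfun fun x => (C x : S.modelSpace))
    (hCs : IsFunctionOf S Csfun fun x => (Cs x : S.modelSpace))
    {K : ℝ} (hK : 0 ≤ K) {h : C(Circle, ℂ)} (hh : ChordLipschitz K h) :
    Represents S.W (clarkRepr B b Cfun Csfun (idCoord * h))
        (Φ.symm (mulH μ e N (idCoord * h) b) : Lp (Cdd d) 2 arcMeasure) ↔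
      Represents S.W (clarkRepr B b Cfun Csfun h)
        (Φ.symm (mulH μ e N h b) : Lp (Cdd d) 2 arcMeasure) := by
  have hU : unitaryOp μ e N (mulH μ e N h b) = mulH μ e N (idCoord * h) b :=
    (mulH_mul idCoord h b).symm
  refine represents_iff_of_recurrence (hC _) (hCs _) (symm_unitaryOp hΦ hagree _ _ hU) ?_
  filter_upwards [ae_measure_singleton_eq_zero μ] with z hz
  exact clarkRepr_idCoord_mul B b Cfun Csfun hK hh hz

theorem represents_character [IsFiniteMeasure μ]
    (hΦ : IsClarkOperator S (perturbation B Γ) Φ) (hagree : AgreesVia S B Φ C Cs)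
    (hC : IsFunctionOf S Cfun fun x => (C x : S.modelSpace))
    (hCs : IsFunctionOf S Csfun fun x => (Cs x : S.modelSpace))
    (hb : b ∈ Set.range B) (n : ℤ) :
    Represents S.W (clarkRepr B b Cfun Csfun (character n))
        (Φ.symm (mulH μ e N (character n) b) : Lp (Cdd d) 2 arcMeasure) := by
  have hstep : ∀ m : ℤ, _ := fun m =>
    represents_idCoord_mul_iff (b := b) hΦ hagree hC hCs
      (K := ‖(m : ℂ)‖ * (Real.pi / 2)) (by have := Real.pi_pos; positivity)
      (chordLipschitz_character m)
  simp only [← character_add_one] at hstep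
  induction n using Int.induction_on with
  | zero =>
    -- At `n = 0` the integral vanishes and the formula reduces to `Φ*Bx = C_*x`. The assumption `b
    -- ∈ Ran B` enters here.
    obtain ⟨x, rfl⟩ := hb
    have h1 : clarkRepr B (B x) Cfun Csfun 1 = fun z => Csfun z x := by
      ext1 z
      rw [clarkRepr_one, adjB_apply]
    rw [character_zero, h1, mulH_one, hagree.2 x]
    exact hCs x
  | succ m hm => exact (hstep m).2 hm
  | pred m hm =>
    rw [← hstep, sub_add_cancel]
    exact hm

theorem represents_of_mem_span [IsFiniteMeasure μ]
    (hΦ : IsClarkOperator S (perturbation B Γ) Φ) (hagree : AgreesVia S B Φ C Cs)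
    (hC : IsFunctionOf S Cfun fun x => (C x : S.modelSpace))
    (hCs : IsFunctionOf S Csfun fun x => (Cs x : S.modelSpace))
    (hb : b ∈ Set.range B) (p : C(Circle, ℂ))
    (hp : p ∈ Submodule.span ℂ (Set.range character)) :
    Represents S.W (clarkRepr B b Cfun Csfun p)
        (Φ.symm (mulH μ e N p b) : Lp (Cdd d) 2 arcMeasure) := by
  induction hp using Submodule.span_induction with
  | mem p hp =>
    obtain ⟨n, rfl⟩ := hp
    exact represents_character hΦ hagree hC hCs hb n
  | zero =>
    have h1 := (represents_character hΦ hagree hC hCs hb 0).smul 0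
    simp only [← clarkRepr_smul] at h1
    rw [← Submodule.coe_smul, ← map_smul, ← mulH_smul, zero_smul] at h1
    exact h1
  | add p q hp hq hp' hq' =>
    -- Additivity of the kernel integral requires integrability of both integrands, which the
    -- Lipschitz bounds supply.
    obtain ⟨K, hK, hpK⟩ := exists_chordLipschitz_of_mem_span p hp
    obtain ⟨L, hL, hqL⟩ := exists_chordLipschitz_of_mem_span q hq
    have h1 := hp'.add hq'
    simp only [← clarkRepr_add B b Cfun Csfun hK hL hpK hqL] at h1
    rw [← Submodule.coe_add, ← map_add, ← mulH_add] at h1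
    exact h1
  | smul c p hp hp' =>
    have h1 := hp'.smul c
    simp only [← clarkRepr_smul] at h1
    rw [← Submodule.coe_smul, ← map_smul, ← mulH_smul] at h1
    exact h1

theorem represents_of_contDiff [IsFiniteMeasure μ]
    (hΦ : IsClarkOperator S (perturbation B Γ) Φ) (hagree : AgreesVia S B Φ C Cs)
    (hC : IsFunctionOf S Cfun fun x => (C x : S.modelSpace))
    (hCs : IsFunctionOf S Csfun fun x => (Cs x : S.modelSpace))
    (hb : b ∈ Set.range B) (h : C(Circle, ℂ))
    (hh : ContDiff ℝ 1 fun t : ℝ => h (Circle.exp t))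
    {K : ℝ} (hK : 0 ≤ K) (hhK : ChordLipschitz K h) :
    Represents S.W (clarkRepr B b Cfun Csfun h)
        (Φ.symm (mulH μ e N h b) : Lp (Cdd d) 2 arcMeasure) := by
  have hε : ∀ n : ℕ, (0 : ℝ) < 1 / ((n : ℝ) + 1) := fun n => Nat.one_div_pos_of_nat
  choose p hp hph hpL using fun n => exists_trigonometric_approx h hh (hε n)
  have hlim : Tendsto p atTop (𝓝 h) := by
    rw [tendsto_iff_norm_sub_tendsto_zero]
    exact squeeze_zero (fun _ => norm_nonneg _) hph tendsto_one_div_add_atTop_nhds_zero_nat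
  refine Represents.of_tendsto (fun n => represents_of_mem_span hΦ hagree hC hCs hb (p n) (hp n))
    (Eventually.of_forall fun z => ?_) ?_
  · have h1 : Tendsto (fun n => chordIntegral B b (p n) z) atTop (𝓝 (chordIntegral B b h z)) := by
      rw [tendsto_iff_norm_sub_tendsto_zero]
      have h0 := (tendsto_one_div_add_atTop_nhds_zero_nat (𝕜 := ℝ)).mul_const
        (∫ ξ, ‖fiberAdj B b ξ‖ ∂μ)
      rw [zero_mul] at h0
      refine squeeze_zero (fun _ => norm_nonneg _) (fun n => ?_) h0
      -- Additivity for `p n = (p n - h) + h` turns the difference of integrals into the integral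
      -- for `p n - h`, whose Lipschitz constant is `1 / (n + 1)`.
      have h2 := chordIntegral_add B b (hε n).le hK (hpL n) hhK z
      rw [sub_add_cancel] at h2
      rw [h2, add_sub_cancel_right]
      exact norm_chordIntegral_le B b (hε n).le (hpL n) z
    have h2 : Tendsto (fun n => p n z) atTop (𝓝 (h z)) :=
      ((continuous_eval_const z).tendsto h).comp hlim
    exact (h2.smul_const _).add (((Csfun z - (z : ℂ) • Cfun z).continuous.tendsto _).comp h1)
  · exact ((continuous_subtype_val.comp Φ.symm.continuous).tendsto _).comp (tendsto_mulH hlim b)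

end Representation

/-- Take `h = p - (p - h)` with a trigonometric polynomial `p` from the approximation at `ε = 1`:
both terms are Lipschitz. -/
theorem exists_chordLipschitz_of_contDiff (h : C(Circle, ℂ))
    (hh : ContDiff ℝ 1 fun t : ℝ => h (Circle.exp t)) : ∃ K, 0 ≤ K ∧ ChordLipschitz K h := by
  obtain ⟨p, hp, -, hpL⟩ := exists_trigonometric_approx h hh one_pos
  obtain ⟨K, hK, hpK⟩ := exists_chordLipschitz_of_mem_span p hp
  have hL : ChordLipschitz 1 (p - h) := hpL
  have h1 := hpK.add (hL.smul (-1))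
  rw [neg_one_smul, neg_sub, add_sub_cancel] at h1
  exact ⟨_, by positivity, h1⟩

end ClarkModel

end

/-! ### The Representation Theorem -/

open ClarkModel in
theorem theorem2p1 {E : Type*} [NormedAddCommGroup E] [InnerProductSpace ℂ E] [CompleteSpace E]
    {M : ℕ∞} (e : HilbertBasis {n : ℕ // (n : ℕ∞) < M} ℂ E)
    (N : Circle → ℕ∞) (hN : Measurable N)
    (μ : Measure Circle) [IsFiniteMeasure μ]
    {d : ℕ} (B : Cd d →ₗᵢ[ℂ] DirectIntegral μ e N)
    (Γ : Cd d →L[ℂ] Cd d) (hΓ : ∀ x, x ≠ 0 → ‖Γ x‖ < ‖x‖)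
    (V : defectSpace (perturbation B Γ) ≃ₗᵢ[ℂ] Cd d)
    (Vs : defectSpace (ContinuousLinearMap.adjoint (perturbation B Γ)) ≃ₗᵢ[ℂ] Cd d)
    (θ : Circle → (Cd d →L[ℂ] Cd d))
    (hθ : IsBoundaryFunction (charFun (perturbation B Γ) V Vs) θ)
    (S : Transcription θ)
    (C : Cd d ≃ₗᵢ[ℂ] defectSpace S.modelOp)
    (Cs : Cd d ≃ₗᵢ[ℂ] defectSpace (ContinuousLinearMap.adjoint S.modelOp))
    (Φ : S.modelSpace ≃ₗᵢ[ℂ] DirectIntegral μ e N)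
    (hΦ : IsClarkOperator S (perturbation B Γ) Φ)
    (hagree : AgreesVia S B Φ C Cs)
    (Cfun Csfun : Circle → (Cd d →L[ℂ] Cdd d))
    (hC : IsFunctionOf S Cfun fun x => (C x : S.modelSpace))
    (hCs : IsFunctionOf S Csfun fun x => (Cs x : S.modelSpace))
    (b : DirectIntegral μ e N) (hb : b ∈ Set.range B)
    (h : C(Circle, ℂ)) (hh : ContDiff ℝ 1 fun t : ℝ => h (Circle.exp t)) :
    Integrable (fiberAdj B b) μ ∧
    adjB B b = ∫ ξ, fiberAdj B b ξ ∂μ ∧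
    (∀ z : Circle, Integrable
      (fun ξ : Circle => ((h ξ - h z) / (1 - (z : ℂ) * conj (ξ : ℂ))) • fiberAdj B b ξ) μ) ∧
    Represents S.W
      (fun z : Circle =>
        h z • Csfun z (adjB B b) +
          (Csfun z - (z : ℂ) • Cfun z)
            (∫ ξ : Circle, ((h ξ - h z) / (1 - (z : ℂ) * conj (ξ : ℂ))) • fiberAdj B b ξ ∂μ))
      (Φ.symm (mulH μ e N h b) : Lp (Cdd d) 2 arcMeasure) := by
  obtain ⟨K, hK, hhK⟩ := exists_chordLipschitz_of_contDiff h hh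
  exact ⟨integrable_fiberAdj B b, adjB_eq_integral B b,
    integrable_chordQuotient_smul B b hK hhK,
    represents_of_contDiff hΦ hagree hC hCs hb h hh hK hhK⟩
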